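/- Let $k$ be an infinite field, $m\ge 0$, and $R=k[x_1,\dots,x_m]$ with its standard grading. For a homogeneous ideal $J\subseteq R$, put $A=R/J=\bigoplus_{n\ge 0}A_n$. A *reduction* of $A$ is an ideal $Q\subseteq A$ generated by linear forms (elements of $A_1$) such that $Q_n=A_n$ for all large $n$, where $Q_n=Q\cap A_n$; it is *minimal* if it contains no other reduction of $A$. For a reduction $Q$ let $r_Q(A)$ be the least integer $n\ge 0$ with $Q_{n+1}=A_{n+1}$, and let the *reduction number* of $A$ be $$r(A)=\min\{\,r_Q(A)\mid Q \text{ is a minimal reduction of } A\,\}.$$ Then for every homogeneous ideal $I\subseteq R$ and every term order on $R$, $$r(R/I)\le r(R/\mathrm{in}(I)),$$ where $\mathrm{in}(I)$ is the initial ideal of $I$, generated by the leading terms of all elements of $I$ with respect to the term order. -/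

import Mathlib

open MvPolynomial

attribute [local instance] MvPolynomial.gradedAlgebra

namespace ReductionNumber

section Graded

variable {k : Type*} [Field k] {A : Type*} [CommRing A] [Algebra k A]

/-- A reduction of the graded algebra `A = ⨁ 𝒜 n`: an ideal `Q` generated by linear forms (elements
of degree one) such that `Q_n = A_n`, that is `A_n ⊆ Q`, for all large `n`. -/
def IsReduction (𝒜 : ℕ → Submodule k A) (Q : Ideal A) : Prop :=
  (∃ s : Set A, s ⊆ (𝒜 1 : Set A) ∧ Q = Ideal.span s) ∧
    ∃ N : ℕ, ∀ n ≥ N, (𝒜 n : Set A) ⊆ (Q : Set A)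

/-- A minimal reduction: a reduction that contains no other reduction. -/
def IsMinimalReduction (𝒜 : ℕ → Submodule k A) (Q : Ideal A) : Prop :=
  Minimal (IsReduction 𝒜) Q

/-- `r_Q(A)`, the least `n ≥ 0` with `Q_{n+1} = A_{n+1}`. For a reduction `Q` such an `n` exists. -/
noncomputable def reductionNumberWrt (𝒜 : ℕ → Submodule k A) (Q : Ideal A) : ℕ :=
  sInf {n : ℕ | (𝒜 (n + 1) : Set A) ⊆ (Q : Set A)}

/-- `r(A)`, the minimum of `r_Q(A)` over all minimal reductions `Q` of `A`. -/
noncomputable def reductionNumber (𝒜 : ℕ → Submodule k A) : ℕ :=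
  sInf {r : ℕ | ∃ Q : Ideal A, IsMinimalReduction 𝒜 Q ∧ reductionNumberWrt 𝒜 Q = r}

end Graded

section Polynomial

variable {k : Type*} [Field k] {m : ℕ}

/-- The grading of `R/I` for a homogeneous ideal `I` of `R = k[x_1, …, x_m]`: its piece of degree
`n` consists of the residue classes of the homogeneous polynomials of degree `n`. -/
noncomputable def quotientGrading (I : Ideal (MvPolynomial (Fin m) k)) (n : ℕ) :
    Submodule k (MvPolynomial (Fin m) k ⧸ I) :=
  (homogeneousSubmodule (Fin m) k n).map (Ideal.Quotient.mkₐ k I).toLinearMap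

/-- The initial ideal `in(I)` with respect to a term order: the ideal generated by the leading
terms of the elements of `I`. -/
noncomputable def initialIdeal (ord : MonomialOrder (Fin m)) (I : Ideal (MvPolynomial (Fin m) k)) :
    Ideal (MvPolynomial (Fin m) k) :=
  Ideal.span (ord.leadingTerm '' (I : Set (MvPolynomial (Fin m) k)))

end Polynomial

end ReductionNumber

namespace ReductionNumber

/-! ### Gröbner degeneration by the torus -/

section Degeneration

/-! Let `W` be a space of linear forms generating a minimal reduction of `R/in(I)` that attains the
reduction number `r`. Lifts of a basis of `W` generate, together with `in(I)`, all forms of degree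
`r + 1`. This spanning condition is open, and `in(I)` is a limit of torus translates of `I`. A
maximal minor expressing it is a polynomial in the torus parameters, and its coefficient at the sum
of the leading exponents is a nonzero minor for `in(I)`. As `k` is infinite, some torus point keeps
the minor nonzero. Moving that point onto the lifts gives a space `V` of linear forms with `dim V ≤
dim W` that generates a reduction of `R/I` with number at most `r` (`exists_scale_of_initialIdeal`,
`exists_submodule_of_initialIdeal`). Minimality of this reduction follows from growth. A basis of
`W` is algebraically independent, as in Noether normalization (`multichoose_le_finrank`), while a
reduction generated by `V'` bounds the growth of `R/I` by that of a polynomial ring in `dim V'`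
variables (`exists_finrank_le`). Since the Hilbert function of `R/in(I)` is at most that of `R/I`,
this gives `dim V ≤ dim W ≤ dim V'`. -/

theorem coeff_prod_of_degree_le {σ R ι : Type*} [CommRing R] (ord : MonomialOrder σ)
    (P : ι → MvPolynomial σ R) (δ : ι → σ →₀ ℕ) (s : Finset ι)
    (h : ∀ i ∈ s, ord.toSyn (ord.degree (P i)) ≤ ord.toSyn (δ i)) :
    coeff (∑ i ∈ s, δ i) (∏ i ∈ s, P i) = ∏ i ∈ s, coeff (δ i) (P i) := by
  classical
  induction s using Finset.induction_on with
  | empty => simp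
  | insert a s ha ih =>
    rw [Finset.sum_insert ha, Finset.prod_insert ha, Finset.prod_insert ha,
      ord.coeff_mul_of_add_of_degree_le, ih]
    · exact fun i hi => h i (Finset.mem_insert_of_mem hi)
    · exact h a (Finset.mem_insert_self _ _)
    · refine ord.degree_prod_le.trans ?_
      rw [map_sum, map_sum]
      exact Finset.sum_le_sum fun i hi => h i (Finset.mem_insert_of_mem hi)

/-- Each term of the determinant uses every row once, so `∑ δ i` bounds its degree, and only the
coefficients at the `δ i` contribute there. -/
theorem coeff_det_of_degree_le {σ R ι : Type*} [CommRing R] [Fintype ι] [DecidableEq ι]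
    (ord : MonomialOrder σ) (M : Matrix ι ι (MvPolynomial σ R)) (δ : ι → σ →₀ ℕ)
    (h : ∀ i j, ord.toSyn (ord.degree (M i j)) ≤ ord.toSyn (δ i)) :
    coeff (∑ i, δ i) M.det = (Matrix.of fun i j => coeff (δ i) (M i j)).det := by
  rw [← Matrix.det_transpose, ← Matrix.det_transpose (Matrix.of _), Matrix.det_apply,
    Matrix.det_apply, coeff_sum]
  refine Finset.sum_congr rfl fun τ _ => ?_
  have := coeff_prod_of_degree_le ord (fun i => M i (τ i)) δ Finset.univ fun i _ => h i _
  have h2 : ∀ (z : ℤˣ) (p : MvPolynomial σ R) d, coeff d (z • p) = z • coeff d p := by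
    intro z p d
    rcases Int.units_eq_one_or z with rfl | rfl <;> simp
  rw [h2]
  exact congrArg _ this

/-- If the top coefficients of a family of vectors of polynomials span the space of vectors, then
so do the values of the family at some point of the torus. -/
theorem exists_span_eval_eq_top {k σ ι κ : Type*} [Field k] [Infinite k] [Fintype σ] [Fintype ι]
    (ord : MonomialOrder σ) (P : κ → ι → MvPolynomial σ k) (δ : κ → σ →₀ ℕ)
    (h : ∀ c i, ord.toSyn (ord.degree (P c i)) ≤ ord.toSyn (δ c))
    (hspan : Submodule.span k (Set.range fun c i => coeff (δ c) (P c i)) = ⊤) :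
    ∃ s : σ → k, (∀ i, s i ≠ 0) ∧
      Submodule.span k (Set.range fun c i => eval s (P c i)) = ⊤ := by
  classical
  obtain ⟨κ', a, -, ha, hli⟩ := exists_linearIndependent' k (fun c i => coeff (δ c) (P c i))
  have b := Module.Basis.mk hli (by rw [ha, hspan])
  let e : ι ≃ κ' := (Pi.basisFun k ι).indexEquiv b
  let g : ι → κ := a ∘ e
  have hg : LinearIndependent k (Matrix.of fun i j => coeff (δ (g i)) (P (g i) j)).row :=
    hli.comp e e.injective
  rw [Matrix.linearIndependent_rows_iff_isUnit, Matrix.isUnit_iff_isUnit_det, isUnit_iff_ne_zero]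
    at hg
  have hD : (Matrix.of fun i j => P (g i) j).det ≠ 0 := by
    intro h0
    apply hg
    have := coeff_det_of_degree_le ord (Matrix.of fun i j => P (g i) j) (fun i => δ (g i))
      (fun i j => h _ _)
    rw [h0, coeff_zero] at this
    exact this.symm
  -- The extra factor, the product of the variables, forces the chosen point into the torus.
  have hX : (∏ i : σ, (X i : MvPolynomial σ k)) ≠ 0 :=
    Finset.prod_ne_zero_iff.2 fun i _ => X_ne_zero i
  obtain ⟨s, hs⟩ : ∃ s, eval s ((Matrix.of fun i j => P (g i) j).det * ∏ i : σ, X i) ≠ 0 := by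
    by_contra! hc
    exact mul_ne_zero hD hX (MvPolynomial.funext fun s => by rw [hc, map_zero])
  rw [map_mul, map_prod] at hs
  simp only [eval_X] at hs
  refine ⟨s, fun i => Finset.prod_ne_zero_iff.1 (right_ne_zero_of_mul hs) i (Finset.mem_univ i), ?_⟩
  have hs1 := left_ne_zero_of_mul hs
  rw [RingHom.map_det, ← isUnit_iff_ne_zero, ← Matrix.isUnit_iff_isUnit_det,
    ← Matrix.linearIndependent_rows_iff_isUnit] at hs1
  have := hs1.span_eq_top_of_card_eq_finrank' (by simp)
  rw [eq_top_iff, ← this]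
  apply Submodule.span_mono
  rintro _ ⟨i, rfl⟩
  exact ⟨g i, rfl⟩

/-- The action of the torus on the polynomial ring by scaling the variables. -/
noncomputable def scale {k σ : Type*} [Field k] (s : σ → k) :
    MvPolynomial σ k →ₐ[k] MvPolynomial σ k :=
  aeval fun i => C (s i) * X i

theorem scale_monomial {k σ : Type*} [Field k] (s : σ → k) (a : σ →₀ ℕ) (c : k) :
    scale s (monomial a c) = monomial a (eval s (monomial a c)) := by
  rw [scale, aeval_monomial, eval_monomial, monomial_eq, algebraMap_eq]
  simp only [mul_pow, Finsupp.prod_mul]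
  rw [C_mul, mul_assoc]
  congr 2
  simp [Finsupp.prod, map_prod]

theorem coeff_scale {k σ : Type*} [Field k] (s : σ → k) (a : σ →₀ ℕ) (f : MvPolynomial σ k) :
    coeff a (scale s f) = eval s (monomial a (coeff a f)) := by
  classical
  induction f using MvPolynomial.induction_on' with
  | monomial b c =>
    rw [scale_monomial, coeff_monomial, coeff_monomial]
    split_ifs with h
    · rw [h]
    · simp
  | add p q hp hq => simp only [map_add, coeff_add, hp, hq]

theorem scale_scale {k σ : Type*} [Field k] {s : σ → k} (hs : ∀ i, s i ≠ 0)
    (f : MvPolynomial σ k) : scale s (scale (fun i => (s i)⁻¹) f) = f := by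
  have : (scale s).comp (scale fun i => (s i)⁻¹) = AlgHom.id k _ := by
    ext1 i
    simp only [scale, AlgHom.comp_apply, aeval_X, map_mul, AlgHom.id_apply, algHom_C, algebraMap_eq]
    rw [← mul_assoc, ← C_mul, inv_mul_cancel₀ (hs i), C_1, one_mul]
  exact DFunLike.congr_fun this f

theorem eval_monomial_injective {k σ : Type*} [Field k] {s : σ → k} (hs : ∀ i, s i ≠ 0)
    (a : σ →₀ ℕ) : Function.Injective fun c => eval s (monomial a c) := by
  intro c d h
  simp only [eval_monomial] at h
  exact mul_right_cancel₀ (Finset.prod_ne_zero_iff.2 fun i _ => pow_ne_zero _ (hs i)) h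

theorem isHomogeneous_scale {k σ : Type*} [Field k] (s : σ → k) {f : MvPolynomial σ k} {n : ℕ}
    (hf : f.IsHomogeneous n) : (scale s f).IsHomogeneous n := by
  intro a ha
  refine hf (d := a) fun h0 => ha ?_
  rw [coeff_scale, h0, map_zero, map_zero]

variable {k : Type*} [Field k] {m : ℕ} (ord : MonomialOrder (Fin m))
  {I : Ideal (MvPolynomial (Fin m) k)}

/-- A term times a leading term of an element of `I` is again such a leading term, so their linear
span is already an ideal. -/
theorem mem_span_leadingTerm_of_mem_initialIdeal {f : MvPolynomial (Fin m) k}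
    (hf : f ∈ initialIdeal ord I) :
    f ∈ Submodule.span k (ord.leadingTerm '' (I : Set (MvPolynomial (Fin m) k))) := by
  induction hf using Submodule.span_induction with
  | mem x hx => exact Submodule.subset_span hx
  | zero => exact zero_mem _
  | add x y _ _ hx hy => exact add_mem hx hy
  | smul p x hxR hx =>
    clear hxR
    rw [smul_eq_mul]
    induction p using MvPolynomial.induction_on' with
    | add p q hp hq => rw [add_mul]; exact add_mem hp hq
    | monomial a c =>
      induction hx using Submodule.span_induction with
      | mem x hx =>
        obtain ⟨g, hg, rfl⟩ := hx
        rw [← ord.leadingTerm_monomial a c, ← ord.leadingTerm_mul]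
        exact Submodule.subset_span ⟨_, I.mul_mem_left _ hg, rfl⟩
      | zero => rw [mul_zero]; exact zero_mem _
      | add x y _ _ hx hy => rw [mul_add]; exact add_mem hx hy
      | smul c x _ hx => rw [mul_smul_comm]; exact Submodule.smul_mem _ _ hx

instance finite_degree_eq (n : ℕ) : Finite {a : Fin m →₀ ℕ // a.degree = n} := by
  refine Set.Finite.subset (Finset.finite_toSet (Finset.univ.finsuppAntidiag n)) ?_
  intro a ha
  have ha : a.degree = n := ha
  simpa [Finsupp.degree_eq_sum] using ha

theorem isHomogeneous_span_of_linear {S : Set (MvPolynomial (Fin m) k)}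
    (hS : ∀ f ∈ S, f.IsHomogeneous 1) :
    (Ideal.span S).IsHomogeneous (homogeneousSubmodule (Fin m) k) :=
  Ideal.homogeneous_span _ _ fun f hf => ⟨1, hS f hf⟩

/-- If linear forms generate everything of degree `n` modulo the initial ideal of `I`, then, after
scaling the variables, they do so modulo `I`. -/
theorem exists_scale_of_initialIdeal [Infinite k]
    (hI : I.IsHomogeneous (homogeneousSubmodule (Fin m) k))
    {S : Set (MvPolynomial (Fin m) k)} (hS : ∀ f ∈ S, f.IsHomogeneous 1) {n : ℕ}
    (hn : ∀ f : MvPolynomial (Fin m) k, f.IsHomogeneous n → f ∈ initialIdeal ord I ⊔ Ideal.span S) :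
    ∃ s : Fin m → k, ∀ f : MvPolynomial (Fin m) k, f.IsHomogeneous n →
      f ∈ I ⊔ Ideal.span (scale s '' S) := by
  classical
  let ι := {a : Fin m →₀ ℕ // a.degree = n}
  have : Fintype ι := Fintype.ofFinite _
  let coord : MvPolynomial (Fin m) k →ₗ[k] ι → k := LinearMap.pi fun a => lcoeff k a.1
  -- As polynomials in the torus parameters, these are the degree `n` coordinates of the translate
  -- of `f ∈ I`, with top coefficients those of its leading term. Elements of the span of `S` stay
  -- fixed.
  let P : I ⊕ Ideal.span S → ι → MvPolynomial (Fin m) k :=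
    Sum.elim (fun f a => monomial a.1 (coeff a.1 f.1)) fun q a => C (coeff a.1 q.1)
  let δ : I ⊕ Ideal.span S → Fin m →₀ ℕ := Sum.elim (fun f => ord.degree f.1) fun _ => 0
  obtain ⟨s, hs, htop⟩ := exists_span_eval_eq_top ord P δ (by
    rintro (f | q) a
    · simp only [P, δ, Sum.elim_inl]
      by_cases h : coeff a.1 f.1 = 0
      · simp [h]
      · rw [ord.degree_monomial, if_neg h]
        exact ord.le_degree (mem_support_iff.2 h)
    · simp [P, δ]) (by
    rw [eq_top_iff]
    rintro v -
    have hv : (∑ a : ι, monomial a.1 (v a) : MvPolynomial (Fin m) k).IsHomogeneous n :=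
      IsHomogeneous.sum _ _ _ fun a _ => isHomogeneous_monomial _ a.2
    have hcv : coord (∑ a : ι, monomial a.1 (v a)) = v := by
      ext a
      simp only [coord, LinearMap.pi_apply, lcoeff_apply, coeff_sum, coeff_monomial]
      rw [Finset.sum_eq_single a (fun b _ hb => if_neg fun h => hb (Subtype.ext h)) (by simp),
        if_pos rfl]
    obtain ⟨j, hj, q, hq, hjq⟩ := Submodule.mem_sup.1 (hn _ hv)
    rw [← hcv, ← hjq, map_add]
    refine add_mem ?_ (Submodule.subset_span ⟨Sum.inr ⟨q, hq⟩, ?_⟩)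
    · have := Submodule.mem_map_of_mem (f := coord) (mem_span_leadingTerm_of_mem_initialIdeal ord hj)
      rw [Submodule.map_span] at this
      refine Submodule.span_mono ?_ this
      rintro _ ⟨_, ⟨f, hf, rfl⟩, rfl⟩
      refine ⟨Sum.inl ⟨f, hf⟩, ?_⟩
      ext a
      simp only [P, δ, Sum.elim_inl, coord, LinearMap.pi_apply, lcoeff_apply,
        MonomialOrder.leadingTerm, coeff_monomial, MonomialOrder.leadingCoeff]
      split_ifs with h1 h2 h2 <;> simp_all
    · ext a
      simp [P, δ, coord])
  -- The point `s` moves `I` and fixes `S`; applying the inverse moves `S` instead.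
  refine ⟨fun i => (s i)⁻¹, fun g hg => ?_⟩
  set T := I ⊔ Ideal.span (scale (fun i => (s i)⁻¹) '' S) with hT
  have hTh : T.IsHomogeneous (homogeneousSubmodule (Fin m) k) := by
    refine hI.sup (isHomogeneous_span_of_linear ?_)
    rintro _ ⟨f, hf, rfl⟩
    exact isHomogeneous_scale _ (hS f hf)
  have hle : (⊤ : Submodule k (ι → k)) ≤
      (T.restrictScalars k).map (coord ∘ₗ (scale s).toLinearMap) := by
    rw [← htop, Submodule.span_le]
    rintro _ ⟨f | q, rfl⟩
    · refine ⟨f.1, (le_sup_left : I ≤ T) f.2, ?_⟩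
      ext a
      simp [P, coord, coeff_scale]
    · refine ⟨scale (fun i => (s i)⁻¹) q.1, (le_sup_right : _ ≤ T) ?_, ?_⟩
      · rw [← Ideal.map_span]
        exact Ideal.mem_map_of_mem _ q.2
      · ext a
        simp [P, coord, scale_scale hs]
  -- The coordinates see only degree `n`, so `g` is just the degree `n` component of `f`;
  -- homogeneity of `T` puts it in `T`.
  obtain ⟨f, hf, hfg⟩ := hle (Submodule.mem_top (x := coord (scale s g)))
  have : g = homogeneousComponent n f := by
    ext a
    rw [coeff_homogeneousComponent]
    split_ifs with h
    · have := congrFun hfg ⟨a, h⟩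
      simp only [LinearMap.comp_apply, coord, LinearMap.pi_apply, lcoeff_apply,
        AlgHom.toLinearMap_apply, coeff_scale] at this
      exact (eval_monomial_injective hs a this).symm
    · exact hg.coeff_eq_zero h
  rw [this]
  exact homogeneousComponent_mem_of_mem hTh hf n

end Degeneration

/-! ### Growth of polynomial rings -/

section Growth

theorem finrank_homogeneousSubmodule_fin (k : Type*) [Field k] (e n : ℕ) :
    Module.finrank k (homogeneousSubmodule (Fin e) k n) = e.multichoose n := by
  rw [homogeneousSubmodule_eq_finsupp_supported,
    (AddMonoidAlgebra.supportedEquivFinsupp (R := k) (S := k)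
      {d : Fin e →₀ ℕ | d.degree = n}).finrank_eq]
  have hset : {d : Fin e →₀ ℕ | d.degree = n} =
      ((Finset.univ : Finset (Fin e)).finsuppAntidiag n : Set (Fin e →₀ ℕ)) := by
    ext a
    simp [Finsupp.degree_eq_sum]
  rw [hset]
  simp [Finset.card_finsuppAntidiag_nat_eq_multichoose]

theorem multichoose_mono_left {d e : ℕ} (h : d ≤ e) (n : ℕ) :
    d.multichoose n ≤ e.multichoose n := by
  induction h with
  | refl => exact le_rfl
  | step _ ih =>
    refine ih.trans ?_
    cases n with
    | zero => simp
    | succ n => rw [Nat.multichoose_succ_succ]; omega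

theorem multichoose_mono_right {d : ℕ} (hd : 0 < d) {n n' : ℕ} (h : n ≤ n') :
    d.multichoose n ≤ d.multichoose n' := by
  obtain ⟨d, rfl⟩ : ∃ d', d = d' + 1 := ⟨d - 1, by omega⟩
  induction h with
  | refl => exact le_rfl
  | step _ ih => rw [Nat.multichoose_succ_succ]; omega

theorem add_mul_multichoose (e n : ℕ) :
    (e + 1 + n) * (e + 1).multichoose n = (e + 1) * (e + 2).multichoose n := by
  rw [Nat.multichoose_eq, Nat.multichoose_eq, show e + 1 + n - 1 = e + n by omega,
    show e + 2 + n - 1 = e + n + 1 by omega,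
    Nat.choose_symm_of_eq_add (show e + n = n + e by omega),
    Nat.choose_symm_of_eq_add (show e + n + 1 = n + (e + 1) by omega)]
  have := Nat.add_one_mul_choose_eq (e + n) e
  linarith

theorem exists_mul_multichoose_lt {d e : ℕ} (h : e < d) (c : ℕ) :
    ∃ n, 1 ≤ n ∧ c * e.multichoose n < d.multichoose n := by
  cases e with
  | zero =>
    refine ⟨1, le_rfl, ?_⟩
    simpa using h
  | succ e =>
    -- One more variable multiplies the count by `(e + 1 + n) / (e + 1)`, which exceeds `c` for this
    -- `n`.
    refine ⟨c * (e + 1) + 1, by omega, lt_of_lt_of_le ?_ (multichoose_mono_left h _)⟩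
    set n := c * (e + 1) + 1
    have h1 := add_mul_multichoose e n
    have hpos : 0 < (e + 1).multichoose n := by
      rw [Nat.multichoose_eq]
      exact Nat.choose_pos (by omega)
    by_contra! hc
    have : (e + 1) * (e + 2).multichoose n ≤ (e + 1) * (c * (e + 1).multichoose n) :=
      Nat.mul_le_mul_left _ hc
    rw [← h1, ← mul_assoc] at this
    have := Nat.le_of_mul_le_mul_right this hpos
    have hn : n = c * (e + 1) + 1 := rfl
    linarith

end Growth

/-! ### Reductions and Hilbert functions of standard graded algebras -/

section StandardGraded

variable {k : Type*} [Field k] {A : Type*} [CommRing A] [Algebra k A] {𝒜 : ℕ → Submodule k A}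

/-- The properties of a standard graded algebra that matter for reductions: it is generated by its
finite-dimensional piece of degree one, and a form of degree `n + 1` in the ideal generated by
a space `W` of linear forms is a combination of elements of `W` with coefficients of degree `n`. -/
structure IsStandardGraded (𝒜 : ℕ → Submodule k A) : Prop where
  pow_one : ∀ n, 𝒜 n = 𝒜 1 ^ n
  finite : FiniteDimensional k (𝒜 1)
  mem_mul : ∀ W ≤ 𝒜 1, ∀ n, ∀ x ∈ 𝒜 (n + 1), x ∈ Ideal.span (W : Set A) → x ∈ W * 𝒜 n

theorem IsReduction.exists_submodule {Q : Ideal A} (hQ : IsReduction 𝒜 Q) :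
    ∃ W ≤ 𝒜 1, Q = Ideal.span (W : Set A) := by
  obtain ⟨⟨s, hs, rfl⟩, -⟩ := hQ
  refine ⟨Submodule.span k s, Submodule.span_le.2 hs, le_antisymm ?_ ?_⟩
  · exact Ideal.span_mono Submodule.subset_span
  · rw [Ideal.span_le]
    have : Submodule.span k s ≤ (Ideal.span s).restrictScalars k :=
      Submodule.span_le.2 Ideal.subset_span
    exact this

theorem finrank_mul_le {M N : Submodule k A} [FiniteDimensional k M] [FiniteDimensional k N] :
    Module.finrank k (M * N : Submodule k A) ≤ Module.finrank k M * Module.finrank k N := by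
  rw [← Submodule.mulMap_range, ← Module.finrank_tensorProduct]
  exact LinearMap.finrank_range_le _

/-- The powers of a space of dimension `e` consist of the values of the forms in `e` variables at
a basis. -/
theorem exists_aeval_eq_of_finrank (W : Submodule k A) [FiniteDimensional k W] :
    ∃ l : Fin (Module.finrank k W) → A, W = Submodule.span k (Set.range l) ∧
      ∀ n, W ^ n = (homogeneousSubmodule (Fin (Module.finrank k W)) k n).map
        (aeval l).toLinearMap := by
  let b := Module.finBasis k W
  have hW : W = Submodule.span k (Set.range fun i => (b i : A)) := by
    have := congrArg (Submodule.map W.subtype) b.span_eq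
    rw [Submodule.map_span, Submodule.map_subtype_top, ← Set.range_comp] at this
    exact this.symm
  refine ⟨fun i => b i, hW, fun n => ?_⟩
  rw [← homogeneousSubmodule_one_pow, Submodule.map_pow,
    homogeneousSubmodule_one_eq_span_X, Submodule.map_span, ← Set.range_comp]
  conv_lhs => rw [hW]
  simp [Function.comp_def]

theorem finrank_pow_le (W : Submodule k A) [FiniteDimensional k W] (n : ℕ) :
    Module.finrank k (W ^ n : Submodule k A) ≤ (Module.finrank k W).multichoose n := by
  obtain ⟨l, -, hl⟩ := exists_aeval_eq_of_finrank W
  have : FiniteDimensional k (homogeneousSubmodule (Fin (Module.finrank k W)) k n) :=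
    Module.Finite.iff_fg.2 (homogeneousSubmodule_fg _ k n)
  rw [hl, ← finrank_homogeneousSubmodule_fin k]
  exact Submodule.finrank_map_le _ _

/-- Take `W` of least dimension among the spaces of linear forms generating `Q`. By minimality of
`Q`, a subspace of `W` that generates a reduction generates `Q` itself. -/
theorem IsMinimalReduction.exists_submodule {Q : Ideal A}
    (hQ : IsMinimalReduction 𝒜 Q) :
    ∃ W ≤ 𝒜 1, Q = Ideal.span (W : Set A) ∧
      ∀ V ≤ W, IsReduction 𝒜 (Ideal.span (V : Set A)) →
        Module.finrank k W ≤ Module.finrank k V := by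
  classical
  have hex : ∃ d, ∃ W ≤ 𝒜 1, Q = Ideal.span (W : Set A) ∧ Module.finrank k W = d := by
    obtain ⟨W, hW, rfl⟩ := hQ.prop.exists_submodule
    exact ⟨_, W, hW, rfl, rfl⟩
  obtain ⟨W, hW, hQW, hd⟩ := Nat.find_spec hex
  refine ⟨W, hW, hQW, fun V hV hVred => ?_⟩
  rw [hd]
  refine Nat.find_min' hex ⟨V, hV.trans hW, ?_, rfl⟩
  have hle : Ideal.span (V : Set A) ≤ Q := hQW ▸ Ideal.span_mono hV
  exact le_antisymm (hQ.le_of_le hVred hle) hle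

theorem aeval_mul_of_isHomogeneous {B σ : Type*} [CommRing B] [Algebra k B]
    {f : MvPolynomial σ k} {n : ℕ} (hf : f.IsHomogeneous n) (p : σ → k) (x : B) :
    aeval (fun i => p i • x) f = eval p f • x ^ n := by
  rw [f.as_sum, map_sum, map_sum, Finset.sum_smul]
  refine Finset.sum_congr rfl fun a ha => ?_
  rw [aeval_monomial, eval_monomial]
  have hd : a.degree = n := hf.degree_eq_sum_deg_support ha ▸ rfl
  rw [← hd, Finsupp.degree_apply]
  simp only [Finsupp.prod, Algebra.smul_def, map_mul, map_prod, map_pow, mul_pow,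
    Finset.prod_mul_distrib, Finset.prod_pow_eq_pow_sum, mul_assoc]

namespace IsStandardGraded

variable (h : IsStandardGraded 𝒜)
include h

theorem add (m n : ℕ) : 𝒜 (m + n) = 𝒜 m * 𝒜 n := by
  rw [h.pow_one, h.pow_one m, h.pow_one n, pow_add]

theorem finiteDimensional (n : ℕ) : FiniteDimensional k (𝒜 n) := by
  have := h.finite
  rw [h.pow_one n]
  exact Module.Finite.iff_fg.2 ((Module.Finite.iff_fg.1 h.finite).pow n)

theorem finiteDimensional_of_le {W : Submodule k A} (hW : W ≤ 𝒜 1) : FiniteDimensional k W :=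
  have := h.finite
  Submodule.finiteDimensional_of_le hW

theorem le_span_of_le {W : Submodule k A} {n n' : ℕ} (hn : n ≤ n')
    (hle : (𝒜 n : Set A) ⊆ Ideal.span (W : Set A)) :
    (𝒜 n' : Set A) ⊆ Ideal.span (W : Set A) := by
  obtain ⟨j, rfl⟩ := Nat.exists_eq_add_of_le hn
  rw [h.add]
  have : 𝒜 n * 𝒜 j ≤ (Ideal.span (W : Set A)).restrictScalars k :=
    Submodule.mul_le.2 fun x hx _ _ => Ideal.mul_mem_right _ _ (hle hx)
  exact this

theorem isReduction_span {W : Submodule k A} (hW : W ≤ 𝒜 1) {n : ℕ}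
    (hle : (𝒜 n : Set A) ⊆ Ideal.span (W : Set A)) : IsReduction 𝒜 (Ideal.span (W : Set A)) :=
  ⟨⟨W, hW, rfl⟩, n, fun _ hn => h.le_span_of_le hn hle⟩

theorem le_of_le_span {V W : Submodule k A} (hV : V ≤ 𝒜 1) (hW : W ≤ 𝒜 1)
    (hVW : (V : Set A) ⊆ Ideal.span (W : Set A)) : V ≤ W := by
  intro x hx
  have := h.mem_mul W hW 0 x (hV hx) (hVW hx)
  rwa [h.pow_one 0, pow_zero, mul_one] at this

/-- A smaller reduction comes from a subspace of `W`, since linear forms in the ideal lie in `W`;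
the dimension bound forces equality. -/
theorem isMinimalReduction_span {W : Submodule k A} (hW : W ≤ 𝒜 1)
    (hred : IsReduction 𝒜 (Ideal.span (W : Set A)))
    (hmin : ∀ V ≤ 𝒜 1, IsReduction 𝒜 (Ideal.span (V : Set A)) →
      Module.finrank k W ≤ Module.finrank k V) :
    IsMinimalReduction 𝒜 (Ideal.span (W : Set A)) := by
  refine ⟨hred, fun Q hQ hle => ?_⟩
  obtain ⟨V, hV, rfl⟩ := hQ.exists_submodule
  have := h.finiteDimensional_of_le hW
  have hVW := h.le_of_le_span hV hW (Ideal.subset_span.trans hle)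
  rw [Submodule.eq_of_le_of_finrank_le hVW (hmin V hV hQ)]

theorem exists_isMinimalReduction : ∃ Q, IsMinimalReduction 𝒜 Q := by
  classical
  have hex : ∃ d, ∃ W ≤ 𝒜 1, IsReduction 𝒜 (Ideal.span (W : Set A)) ∧
      Module.finrank k W = d :=
    ⟨_, 𝒜 1, le_rfl, h.isReduction_span le_rfl Ideal.subset_span, rfl⟩
  obtain ⟨W, hW, hred, hd⟩ := Nat.find_spec hex
  refine ⟨_, h.isMinimalReduction_span hW hred fun V hV hVred => ?_⟩
  rw [hd]
  exact Nat.find_min' hex ⟨V, hV, hVred, rfl⟩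

theorem le_mul_pow {W : Submodule k A} (hW : W ≤ 𝒜 1) {N : ℕ}
    (hN : ∀ n ≥ N, (𝒜 n : Set A) ⊆ Ideal.span (W : Set A)) (n : ℕ) :
    𝒜 (N + n) ≤ 𝒜 N * W ^ n := by
  induction n with
  | zero => simp
  | succ n ih =>
    calc 𝒜 (N + n + 1) ≤ W * 𝒜 (N + n) := fun x hx =>
          h.mem_mul W hW _ x hx (hN _ (by omega) hx)
      _ ≤ W * (𝒜 N * W ^ n) := mul_le_mul' le_rfl ih
      _ = 𝒜 N * W ^ (n + 1) := by ring

/-- The graded pieces grow at most as fast as those of a polynomial ring in as many variables as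
a reduction has generators. -/
theorem exists_finrank_le {W : Submodule k A} (hW : W ≤ 𝒜 1)
    (hred : IsReduction 𝒜 (Ideal.span (W : Set A))) :
    ∃ c N, ∀ n, Module.finrank k (𝒜 (N + n)) ≤ c * (Module.finrank k W).multichoose n := by
  obtain ⟨-, N, hN⟩ := hred
  refine ⟨Module.finrank k (𝒜 N), N, fun n => ?_⟩
  have := h.finiteDimensional N
  have := h.finiteDimensional_of_le hW
  have hfin : FiniteDimensional k (W ^ n : Submodule k A) :=
    Module.Finite.iff_fg.2 ((Module.Finite.iff_fg.1 this).pow n)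
  have : FiniteDimensional k (𝒜 N * W ^ n : Submodule k A) :=
    Module.Finite.iff_fg.2 ((Module.Finite.iff_fg.1 inferInstance).mul
      (Module.Finite.iff_fg.1 inferInstance))
  exact (Submodule.finrank_mono (h.le_mul_pow hW hN n)).trans
    (finrank_mul_le.trans (Nat.mul_le_mul_left _ (finrank_pow_le W n)))

/-- If no proper subspace of `W` generates a reduction, then there are no relations among the
elements of a basis of `W`, so the graded pieces are at least as large as those of a polynomial
ring. -/
theorem multichoose_le_finrank [Infinite k] {W : Submodule k A} (hW : W ≤ 𝒜 1)
    (hred : IsReduction 𝒜 (Ideal.span (W : Set A)))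
    (hmin : ∀ V ≤ W, IsReduction 𝒜 (Ideal.span (V : Set A)) →
      Module.finrank k W ≤ Module.finrank k V) {n : ℕ} (hn : 1 ≤ n) :
    (Module.finrank k W).multichoose n ≤ Module.finrank k (𝒜 n) := by
  have := h.finiteDimensional_of_le hW
  have := h.finiteDimensional n
  obtain ⟨l, hlW, hl⟩ := exists_aeval_eq_of_finrank W
  suffices hinj : ∀ f : MvPolynomial (Fin (Module.finrank k W)) k, f.IsHomogeneous n →
      aeval l f = 0 → f = 0 by
    have hle : W ^ n ≤ 𝒜 n := h.pow_one n ▸ pow_le_pow_left' hW n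
    refine le_trans (le_of_eq ?_) (Submodule.finrank_mono hle)
    rw [hl, ← finrank_homogeneousSubmodule_fin k, ← LinearMap.range_domRestrict]
    refine (LinearMap.finrank_range_of_inj ?_).symm
    rw [injective_iff_map_eq_zero]
    exact fun f hf => Subtype.ext (hinj f.1 f.2 hf)
  intro f hf hf0
  by_contra hne
  obtain ⟨p, hp⟩ : ∃ p, eval p f ≠ 0 := by
    by_contra! hc
    exact hne (MvPolynomial.funext fun s => by rw [hc, map_zero])
  -- A form of positive degree vanishes at the origin.
  obtain ⟨i, hi⟩ : ∃ i, p i ≠ 0 := by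
    by_contra! hc
    apply hp
    have := aeval_mul_of_isHomogeneous hf (fun _ => (0 : k)) (0 : k)
    rw [show p = fun _ => (0 : k) • (0 : k) by ext i; simp [hc i], ← coe_aeval_eq_eval]
    simp only [RingHom.coe_coe]
    rw [this, zero_pow (by omega), smul_zero]
  classical
  -- Modulo the `v j`, the tuple `l` is proportional to `p`, so the relation `f` becomes a nonzero
  -- multiple of `l i ^ n`. Hence `W ^ n` dies and `V`, of smaller dimension, generates a reduction.
  let v : Fin (Module.finrank k W) → A := fun j => l j - (p j / p i) • l i
  let V : Submodule k A := Submodule.span k (v '' (Finset.univ.erase i))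
  have hlmem : ∀ j, l j ∈ W := fun j => by
    have := Submodule.subset_span (R := k) (Set.mem_range_self (f := l) j)
    rwa [← hlW] at this
  have hVW : V ≤ W := by
    rw [Submodule.span_le]
    rintro _ ⟨j, -, rfl⟩
    exact sub_mem (hlmem j) (W.smul_mem _ (hlmem i))
  have hVfin : Module.finrank k V < Module.finrank k W := by
    have h1 := finrank_span_finset_le_card (R := k) ((Finset.univ.erase i).image v)
    have h2 : ((Finset.univ.erase i).image v).card ≤ (Finset.univ.erase i).card :=
      Finset.card_image_le
    rw [Finset.card_erase_of_mem (Finset.mem_univ i), Finset.card_univ, Fintype.card_fin] at h2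
    rw [Finset.coe_image] at h1
    have := i.pos
    have : Module.finrank k V ≤ _ := h1
    omega
  refine (hmin V hVW ?_).not_gt hVfin
  let π := Ideal.Quotient.mkₐ k (Ideal.span (V : Set A))
  have hπ : ∀ x, π x = 0 ↔ x ∈ Ideal.span (V : Set A) := fun x => Ideal.Quotient.eq_zero_iff_mem
  have hπl : ∀ j, π (l j) = p j • (p i)⁻¹ • π (l i) := by
    intro j
    rw [smul_smul, ← div_eq_mul_inv, ← map_smul, ← sub_eq_zero, ← map_sub, hπ]
    by_cases hj : j = i
    · subst hj
      rw [div_self hi, one_smul, sub_self]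
      exact zero_mem _
    · exact Ideal.subset_span (Submodule.subset_span ⟨j, by simp [hj], rfl⟩)
  have hpow : π (l i) ^ n = 0 := by
    have h1 := congrArg π hf0
    rw [comp_aeval_apply, map_zero, funext hπl, aeval_mul_of_isHomogeneous hf, smul_pow,
      smul_smul] at h1
    exact (smul_eq_zero.1 h1).resolve_left (mul_ne_zero hp (pow_ne_zero _ (inv_ne_zero hi)))
  have hWn : (W ^ n).map π.toLinearMap = ⊥ := by
    rw [eq_bot_iff, Submodule.map_pow]
    have hle : W.map π.toLinearMap ≤ Submodule.span k {π (l i)} := by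
      conv_lhs => rw [hlW]
      rw [Submodule.map_span, Submodule.span_le]
      rintro _ ⟨_, ⟨j, rfl⟩, rfl⟩
      exact Submodule.mem_span_singleton.2 ⟨p j * (p i)⁻¹, (mul_smul _ _ _).trans (hπl j).symm⟩
    refine (pow_le_pow_left' hle n).trans ?_
    simp [Submodule.span_pow, hpow]
  obtain ⟨-, N, hN⟩ := hred
  refine h.isReduction_span (hVW.trans hW) (n := N + n) ?_
  have hle : 𝒜 N * W ^ n ≤ (Ideal.span (V : Set A)).restrictScalars k := by
    refine Submodule.mul_le.2 fun x _ y hy => Ideal.mul_mem_left _ _ ((hπ y).1 ?_)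
    have := Submodule.mem_map_of_mem (f := π.toLinearMap) hy
    rwa [hWn, Submodule.mem_bot] at this
  exact (h.le_mul_pow hW hN n).trans hle

end IsStandardGraded

end StandardGraded

namespace IsStandardGraded

variable {k : Type*} [Field k] {A B : Type*} [CommRing A] [Algebra k A] [CommRing B] [Algebra k B]
  {𝒜 : ℕ → Submodule k A} {ℬ : ℕ → Submodule k B}

/-- If `dim V < dim W`, the lower bound from `W` outgrows every multiple of the upper bound from
`V`. -/
theorem finrank_le_finrank [Infinite k] (hA : IsStandardGraded 𝒜) (hB : IsStandardGraded ℬ)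
    (hAB : ∀ n, Module.finrank k (𝒜 n) ≤ Module.finrank k (ℬ n))
    {W : Submodule k A} (hW : W ≤ 𝒜 1) (hWred : IsReduction 𝒜 (Ideal.span (W : Set A)))
    (hmin : ∀ V ≤ W, IsReduction 𝒜 (Ideal.span (V : Set A)) →
      Module.finrank k W ≤ Module.finrank k V)
    {V : Submodule k B} (hV : V ≤ ℬ 1) (hVred : IsReduction ℬ (Ideal.span (V : Set B))) :
    Module.finrank k W ≤ Module.finrank k V := by
  by_contra! hlt
  obtain ⟨c, N, hc⟩ := hB.exists_finrank_le hV hVred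
  obtain ⟨n, hn, hlt'⟩ := exists_mul_multichoose_lt hlt c
  have h1 := hA.multichoose_le_finrank hW hWred hmin (n := N + n) (by omega)
  have h2 := multichoose_mono_right (Nat.zero_lt_of_lt hlt) (Nat.le_add_left n N)
  have := hAB (N + n)
  have := hc n
  omega

end IsStandardGraded

/-! ### Quotients by `I` and by its initial ideal -/

section Quotient

variable {k : Type*} [Field k] {m : ℕ} {I : Ideal (MvPolynomial (Fin m) k)}

theorem mem_quotientGrading {n : ℕ} {x : MvPolynomial (Fin m) k ⧸ I} :
    x ∈ quotientGrading I n ↔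
      ∃ f : MvPolynomial (Fin m) k, f.IsHomogeneous n ∧ Ideal.Quotient.mk I f = x :=
  Iff.rfl

theorem homogeneousComponent_mul_of_isHomogeneous_one {f g : MvPolynomial (Fin m) k}
    (hf : f.IsHomogeneous 1) (n : ℕ) :
    homogeneousComponent (n + 1) (f * g) = f * homogeneousComponent n g := by
  conv_lhs => rw [← g.sum_homogeneousComponent, Finset.mul_sum, map_sum]
  have hi : ∀ i, homogeneousComponent (n + 1) (f * homogeneousComponent i g) =
      if i = n then f * homogeneousComponent n g else 0 := by
    intro i
    have : (f * homogeneousComponent i g).IsHomogeneous (i + 1) := by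
      rw [add_comm]
      exact hf.mul (homogeneousComponent_isHomogeneous i g)
    rw [homogeneousComponent_of_mem this]
    by_cases h : i = n
    · subst h; simp
    · rw [if_neg (by omega), if_neg h]
  rw [Finset.sum_congr rfl fun i _ => hi i, Finset.sum_ite_eq']
  split_ifs with h
  · rfl
  · rw [homogeneousComponent_eq_zero _ _ (by simpa using h), mul_zero]

theorem isStandardGraded_quotientGrading
    (hI : I.IsHomogeneous (homogeneousSubmodule (Fin m) k)) :
    IsStandardGraded (quotientGrading I) where
  pow_one n := by
    rw [quotientGrading, quotientGrading, ← homogeneousSubmodule_one_pow, Submodule.map_pow]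
  finite := Module.Finite.iff_fg.2 ((homogeneousSubmodule_fg _ k 1).map _)
  mem_mul W hW n x hx hxW := by
    obtain ⟨f, hf, rfl⟩ := mem_quotientGrading.1 hx
    obtain ⟨r, c, w, hcw⟩ := Submodule.mem_span_set'.1 hxW
    choose l hl hlw using fun i => mem_quotientGrading.1 (hW (w i).2)
    choose g hg using fun i => Ideal.Quotient.mk_surjective (c i)
    have hmem : f - ∑ i, l i * g i ∈ I := by
      rw [← Ideal.Quotient.eq, ← hcw, map_sum]
      exact Finset.sum_congr rfl fun i _ => by rw [map_mul, hg, hlw, smul_eq_mul, mul_comm]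
    -- Passing to degree `n + 1` replaces each coefficient `g i` by its component of degree `n`.
    have hmem' := homogeneousComponent_mem_of_mem hI hmem (n + 1)
    rw [map_sub, map_sum, homogeneousComponent_eq_self hf, ← Ideal.Quotient.eq, map_sum] at hmem'
    rw [hmem']
    refine sum_mem fun i _ => ?_
    rw [homogeneousComponent_mul_of_isHomogeneous_one (hl i), map_mul, hlw]
    exact Submodule.mul_mem_mul (w i).2 ⟨_, homogeneousComponent_isHomogeneous n _, rfl⟩

variable (ord : MonomialOrder (Fin m)) (I)

theorem isHomogeneous_initialIdeal :
    (initialIdeal ord I).IsHomogeneous (homogeneousSubmodule (Fin m) k) := by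
  refine Ideal.homogeneous_span _ _ ?_
  rintro _ ⟨f, -, rfl⟩
  exact ⟨_, isHomogeneous_monomial _ rfl⟩

/-- Monomials outside the initial ideal of `I` are linearly independent modulo `I`. -/
theorem eq_zero_of_mem_of_support {f : MvPolynomial (Fin m) k} (hf : f ∈ I)
    (hsupp : ∀ a ∈ f.support, monomial a 1 ∉ initialIdeal ord I) : f = 0 := by
  by_contra hne
  refine hsupp _ (ord.degree_mem_support hne) ?_
  have h1 : ord.leadingTerm f ∈ initialIdeal ord I := Ideal.subset_span ⟨f, hf, rfl⟩
  have h2 := (initialIdeal ord I).mul_mem_left (C (ord.leadingCoeff f)⁻¹) h1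
  rwa [MonomialOrder.leadingTerm, C_mul_monomial,
    inv_mul_cancel₀ (ord.leadingCoeff_ne_zero_iff.2 hne)] at h2

/-- The degree `n` monomials outside `in(I)` span this piece of `R/in(I)` and stay independent in
`R/I`. -/
theorem finrank_quotientGrading_initialIdeal_le (n : ℕ) :
    Module.finrank k (quotientGrading (initialIdeal ord I) n) ≤
      Module.finrank k (quotientGrading I n) := by
  set J := initialIdeal ord I
  let S : Submodule k (MvPolynomial (Fin m) k) :=
    homogeneousSubmodule (Fin m) k n ⊓ restrictSupport k {a | monomial a 1 ∉ J}
  have hfin : FiniteDimensional k (homogeneousSubmodule (Fin m) k n) :=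
    Module.Finite.iff_fg.2 (homogeneousSubmodule_fg _ k n)
  have : FiniteDimensional k S := Submodule.finiteDimensional_of_le inf_le_left
  have : FiniteDimensional k (quotientGrading I n) :=
    Module.Finite.iff_fg.2 ((homogeneousSubmodule_fg _ k n).map _)
  calc Module.finrank k (quotientGrading J n)
      ≤ Module.finrank k (S.map (Ideal.Quotient.mkₐ k J).toLinearMap) := by
        refine Submodule.finrank_mono ?_
        rintro _ ⟨f, hf, rfl⟩
        rw [f.as_sum, map_sum]
        refine sum_mem fun a ha => ?_
        have hdeg : a.degree = n := by
          by_contra h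
          exact mem_support_iff.1 ha (hf.coeff_eq_zero h)
        by_cases haJ : monomial a 1 ∈ J
        · have h2 : monomial a (coeff a f) ∈ J := by
            have := J.mul_mem_left (C (coeff a f)) haJ
            rwa [C_mul_monomial, mul_one] at this
          have h3 : (Ideal.Quotient.mkₐ k J).toLinearMap (monomial a (coeff a f)) = 0 :=
            Ideal.Quotient.eq_zero_iff_mem.2 h2
          rw [h3]
          exact zero_mem _
        · refine Submodule.mem_map_of_mem ⟨isHomogeneous_monomial _ hdeg, ?_⟩
          refine (mem_restrictSupport_iff k).2 fun b hb => ?_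
          obtain rfl := Finset.mem_singleton.1 (support_monomial_subset hb)
          exact haJ
    _ ≤ Module.finrank k S := Submodule.finrank_map_le _ _
    _ = Module.finrank k (S.map (Ideal.Quotient.mkₐ k I).toLinearMap) := by
        rw [← LinearMap.range_domRestrict]
        refine (LinearMap.finrank_range_of_inj ?_).symm
        rw [injective_iff_map_eq_zero]
        intro f hf
        refine Subtype.ext (eq_zero_of_mem_of_support I ord (Ideal.Quotient.eq_zero_iff_mem.1 hf) ?_)
        exact fun a ha => (mem_restrictSupport_iff k).1 f.2.2 ha
    _ ≤ Module.finrank k (quotientGrading I n) :=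
        Submodule.finrank_mono (Submodule.map_mono inf_le_left)

variable {I}

/-- A space of linear forms generating the piece of degree `n` of `R / in(I)` can be deformed to
a space of at most the same dimension generating the piece of degree `n` of `R / I`. -/
theorem exists_submodule_of_initialIdeal [Infinite k]
    (hI : I.IsHomogeneous (homogeneousSubmodule (Fin m) k))
    {W : Submodule k (MvPolynomial (Fin m) k ⧸ initialIdeal ord I)}
    (hW : W ≤ quotientGrading (initialIdeal ord I) 1) {n : ℕ}
    (hn : ∀ x ∈ quotientGrading (initialIdeal ord I) n, x ∈ Ideal.span (W : Set _)) :
    ∃ V ≤ quotientGrading I 1, Module.finrank k V ≤ Module.finrank k W ∧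
      ∀ x ∈ quotientGrading I n, x ∈ Ideal.span (V : Set (MvPolynomial (Fin m) k ⧸ I)) := by
  have := (isStandardGraded_quotientGrading
    (isHomogeneous_initialIdeal I ord)).finiteDimensional_of_le hW
  obtain ⟨l, hl, -⟩ := exists_aeval_eq_of_finrank W
  have hlmem : ∀ i, l i ∈ W := fun i => by
    have := Submodule.subset_span (R := k) (Set.mem_range_self (f := l) i)
    rwa [← hl] at this
  choose g hg hgl using fun i => mem_quotientGrading.1 (hW (hlmem i))
  obtain ⟨s, hs⟩ := exists_scale_of_initialIdeal ord hI (S := Set.range g)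
    (by rintro _ ⟨i, rfl⟩; exact hg i) (n := n) (by
      intro f hf
      have hf' : Ideal.Quotient.mk (initialIdeal ord I) f ∈ Ideal.span (W : Set _) :=
        hn _ (mem_quotientGrading.2 ⟨f, hf, rfl⟩)
      have hle : Ideal.span (W : Set _) ≤
          (Ideal.span (Set.range g)).map (Ideal.Quotient.mk (initialIdeal ord I)) := by
        rw [Ideal.span_le]
        have : W ≤ ((Ideal.span (Set.range g)).map
            (Ideal.Quotient.mk (initialIdeal ord I))).restrictScalars k := by
          conv_lhs => rw [hl]
          rw [Submodule.span_le]
          rintro _ ⟨i, rfl⟩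
          rw [← hgl]
          exact Ideal.mem_map_of_mem _ (Ideal.subset_span ⟨i, rfl⟩)
        exact this
      have := Ideal.mem_comap.2 (hle hf')
      rwa [Ideal.comap_map_of_surjective' _ Ideal.Quotient.mk_surjective, Ideal.mk_ker,
        sup_comm] at this)
  have hfin := finrank_range_le_card (R := k) fun i => Ideal.Quotient.mk I (scale s (g i))
  rw [Fintype.card_fin] at hfin
  refine ⟨Submodule.span k (Set.range fun i => Ideal.Quotient.mk I (scale s (g i))),
    ?_, hfin, ?_⟩
  · rw [Submodule.span_le]
    rintro _ ⟨i, rfl⟩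
    exact ⟨_, isHomogeneous_scale s (hg i), rfl⟩
  · rintro _ ⟨f, hf, rfl⟩
    obtain ⟨x, hx, y, hy, rfl⟩ := Submodule.mem_sup.1 (hs f hf)
    have hx0 : Ideal.Quotient.mk I x = 0 := Ideal.Quotient.eq_zero_iff_mem.2 hx
    change Ideal.Quotient.mk I (x + y) ∈ Ideal.span _
    rw [map_add, hx0, zero_add]
    have := Ideal.mem_map_of_mem (Ideal.Quotient.mk I) hy
    rw [Ideal.map_span] at this
    refine Ideal.span_mono ?_ this
    rintro _ ⟨_, ⟨_, ⟨i, rfl⟩, rfl⟩, rfl⟩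
    exact Submodule.subset_span ⟨i, rfl⟩

/-- The reduction number does not decrease under passage to an initial ideal. -/
theorem reductionNumber_le_reductionNumber_initialIdeal [Infinite k]
    (hI : I.IsHomogeneous (homogeneousSubmodule (Fin m) k)) :
    reductionNumber (quotientGrading I) ≤
      reductionNumber (quotientGrading (initialIdeal ord I)) := by
  have hA := isStandardGraded_quotientGrading hI
  have hB := isStandardGraded_quotientGrading (isHomogeneous_initialIdeal I ord)
  -- The infimum of the empty set is `0`, so both infima for `R/in(I)` are attained only once their
  -- sets are known to be nonempty.
  obtain ⟨Q₀, hQ₀⟩ := hB.exists_isMinimalReduction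
  obtain ⟨Q, hQ, hr⟩ := Nat.sInf_mem (s := {r : ℕ | ∃ Q, IsMinimalReduction
    (quotientGrading (initialIdeal ord I)) Q ∧
      reductionNumberWrt (quotientGrading (initialIdeal ord I)) Q = r}) ⟨_, Q₀, hQ₀, rfl⟩
  obtain ⟨W, hW, rfl, hmin⟩ := hQ.exists_submodule
  have hn := Nat.sInf_mem (s := {n : ℕ | (quotientGrading (initialIdeal ord I) (n + 1) :
    Set (MvPolynomial (Fin m) k ⧸ initialIdeal ord I)) ⊆
      (Ideal.span (W : Set (MvPolynomial (Fin m) k ⧸ initialIdeal ord I)) : Set _)}) (by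
      obtain ⟨-, N, hN⟩ := hQ.prop
      exact ⟨N, hN _ (Nat.le_succ N)⟩)
  obtain ⟨V, hV, hVW, hVn⟩ := exists_submodule_of_initialIdeal ord hI hW hn
  have hVmin := hA.isMinimalReduction_span hV (hA.isReduction_span hV hVn) fun V' hV' hred =>
    hVW.trans (hB.finrank_le_finrank hA (finrank_quotientGrading_initialIdeal_le I ord) hW hQ.prop
      hmin hV' hred)
  have hle : reductionNumber (quotientGrading I) ≤
      reductionNumberWrt (quotientGrading I) (Ideal.span (V : Set _)) :=
    Nat.sInf_le ⟨_, hVmin, rfl⟩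
  exact le_of_le_of_eq (hle.trans (Nat.sInf_le hVn)) hr

end Quotient

end ReductionNumber

theorem corollary3p4 {k : Type*} [Field k] [Infinite k] (m : ℕ) (ord : MonomialOrder (Fin m))
    (I : Ideal (MvPolynomial (Fin m) k))
    (hI : I.IsHomogeneous (MvPolynomial.homogeneousSubmodule (Fin m) k)) :
    ReductionNumber.reductionNumber (ReductionNumber.quotientGrading I) ≤
      ReductionNumber.reductionNumber
        (ReductionNumber.quotientGrading (ReductionNumber.initialIdeal ord I)) :=
  ReductionNumber.reductionNumber_le_reductionNumber_initialIdeal ord hI
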